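/- Words are over the alphabet $\{0,1\}$. An infinite word $x=x_1x_2\ldots$ is Sturmian if it has exactly $n+1$ factors of length $n$ for every $n\ge 1$; it has slope $\alpha$ if $|u|_1/|u|\to\alpha$ as $|u|\to\infty$, $u$ ranging over the factors of $x$, where $|u|_1$ is the number of $1$'s in $u$. $T$ is the shift, which deletes the first letter. Let $\alpha=[0;a_1,a_2,\ldots]\in\,]0,1[$ be irrational, with continuants $q_0=1$, $q_1=a_1$, $q_{n+1}=a_{n+1}q_n+q_{n-1}$ for $n\ge1$. There is a unique Sturmian word $c_\alpha$ of slope $\alpha$ (the characteristic word) such that, for every Sturmian word $x$ of slope $\alpha$ and every $n\ge1$, the prefix $L_n$ of length $n$ of $c_\alpha$ is a left special factor of $x$ (both $0L_n$ and $1L_n$ are factors of $x$). A formal intercept of $\alpha$ is a sequence of integers $\rho=(\rho_n)_{n\ge0}$ with $0\le\rho_n<q_n$ and $\rho_{n+1}\equiv\rho_n \pmod{q_n}$ for all $n\ge 0$ (so $\rho_0=0$). (a) For every formal intercept $\rho$ of $\alpha$, the limit (letter by letter) $T^{\rho}(c_\alpha)=\lim_{n\to\infty}T^{\rho_n}(c_\alpha)$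 exists, is a Sturmian word of slope $\alpha$, and has the same prefix of length $q_n-1$ as $T^{\rho_n}(c_\alpha)$ for every $n\ge0$. (b) For every Sturmian word $x$ of slope $\alpha$ there is a unique formal intercept $\rho$ of $\alpha$ such that $x=T^\rho(c_\alpha)$. Hence $\rho\mapsto T^\rho(c_\alpha)$ is a bijection from the formal intercepts of $\alpha$ onto the Sturmian words of slope $\alpha$. (c) The map sending $(b_i)_{i\ge1}$ to $\rho=(\rho_n)_{n\ge 0}$ with $\rho_n=\sum_{i=0}^{n-1}b_{i+1}q_i$ is a bijection from the sequences of integers $(b_i)_{i\ge1}$ satisfying the Ostrowski conditions ($0\le b_1\le a_1-1$; $0\le b_i\le a_i$ for $i\ge1$; $b_{i+1}=a_{i+1}\Rightarrow b_i=0$ for $i\ge1$) onto the formal intercepts of $\alpha$. -/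

import Mathlib

open Filter Topology

namespace Sturmian

/-- Infinite words `x = x₁ x₂ x₃ …` over the alphabet `{0, 1}`; the letter `x_{i+1}` is `x i`. As a
topological space this is the product of discrete spaces. -/
abbrev Word : Type := ℕ → Fin 2

/-- The factor of length `n` of `x` that occurs at position `i`. -/
def factor (x : Word) (i n : ℕ) : List (Fin 2) := List.ofFn fun j : Fin n => x (i + j)

/-- The prefix of length `n` of `x`. -/
def firstLetters (x : Word) (n : ℕ) : List (Fin 2) := factor x 0 n

/-- `u` occurs in `x`. -/
def IsFactor (x : Word) (u : List (Fin 2)) : Prop := ∃ i, u = factor x i u.length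

/-- The complexity function `p(x, n)`: the number of factors of length `n`. -/
noncomputable def complexity (x : Word) (n : ℕ) : ℕ := (Set.range fun i => factor x i n).ncard

/-- `x` is Sturmian: `p(x, n) = n + 1` for all `n ≥ 1`. -/
def IsSturmian (x : Word) : Prop := ∀ n, 1 ≤ n → complexity x n = n + 1

/-- `x` has slope `α`: the frequency `|u|₁ / |u|` tends to `α` as `|u| → ∞`, where `u` runs over the
factors of `x`. -/
def HasSlope (x : Word) (α : ℝ) : Prop :=
  ∀ ε : ℝ, 0 < ε → ∃ N : ℕ, ∀ u : List (Fin 2), IsFactor x u → N ≤ u.length →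
    |(u.count 1 : ℝ) / (u.length : ℝ) - α| < ε

/-- The shift map `T`, which removes the first letter. -/
def shift (x : Word) : Word := fun i => x (i + 1)

/-- `u` is a left special factor of `x`: both `0u` and `1u` are factors of `x`. -/
def IsLeftSpecial (x : Word) (u : List (Fin 2)) : Prop := IsFactor x (0 :: u) ∧ IsFactor x (1 :: u)

/-- `c` is the characteristic word of slope `α`: it is a Sturmian word of slope `α` and, for every
Sturmian word `x` of slope `α`, it is the limit of the left special factors of `x`, that is, its
prefix of length `n` is a left special factor of `x` for every `n ≥ 1`. -/
def IsCharacteristic (α : ℝ) (c : Word) : Prop :=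
  IsSturmian c ∧ HasSlope c α ∧
    ∀ x : Word, IsSturmian x → HasSlope x α → ∀ n, 1 ≤ n → IsLeftSpecial x (firstLetters c n)

/-- The characteristic word `c_α` of slope `α`. -/
noncomputable def characteristicWord (α : ℝ) : Word := Classical.epsilon (IsCharacteristic α)

/-- The partial quotients of `α = [0; a₁, a₂, …]`, for irrational `α` in `(0, 1)`: the value at `i`
is `a_{i+1}`. -/
noncomputable def partialQuotient (α : ℝ) (i : ℕ) : ℕ :=
  ⌊((GenContFract.of α).partDens.get? i).getD 0⌋₊

/-- The continuants `q₀ = 1`, `q₁ = a₁`, `q_{n+2} = a_{n+2} q_{n+1} + q_n` of `α`. -/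
noncomputable def continuant (α : ℝ) : ℕ → ℕ
  | 0 => 1
  | 1 => partialQuotient α 0
  | n + 2 => partialQuotient α (n + 1) * continuant α (n + 1) + continuant α n

/-- The formal intercepts of the slope `α`: the sequences `ρ` with `0 ≤ ρ_n < q_n` and
`ρ_{n+1} ≡ ρ_n` modulo `q_n`. The entry `ρ₀` is `0`, because `q₀ = 1`. -/
def formalIntercepts (α : ℝ) : Set (ℕ → ℕ) :=
  {ρ | (∀ n, ρ n < continuant α n) ∧ ∀ n, ρ (n + 1) ≡ ρ n [MOD continuant α n]}

/-- The word `T^ρ(x) = lim T^{ρ_n}(x)`. -/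
noncomputable def formalShift (ρ : ℕ → ℕ) (x : Word) : Word :=
  limUnder atTop fun n => shift^[ρ n] x

/-- The Ostrowski conditions on a sequence of digits; `b i` is the digit `b_{i+1}`, the coefficient
of `q_i`. -/
def IsOstrowski (α : ℝ) (b : ℕ → ℕ) : Prop :=
  b 0 + 1 ≤ partialQuotient α 0 ∧ (∀ i, b i ≤ partialQuotient α i) ∧
    ∀ i, b (i + 1) = partialQuotient α (i + 1) → b i = 0

/-- The partial sums of `∑ b_{i+1} q_i`. -/
noncomputable def ostrowskiSums (α : ℝ) (b : ℕ → ℕ) : ℕ → ℕ :=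
  fun n => ∑ i ∈ Finset.range n, b i * continuant α i

end Sturmian

/-! The Sturmian words of slope `α` are exactly the words all of whose factors `u` satisfy `| |u|₁ -
α|u| | < 1` (`isBalancedWithSlope_iff`). They share one language: at most `n + 1` words of length
`n` satisfy the bound together with all their factors (`ncard_slopeLanguage_le`), while aperiodicity
forces at least `n + 1` factors (`HasSlope.lt_complexity`). The mechanical word `c` satisfies the
bound even when either letter is put in front of it, so its prefixes are the left special words and
`c` is the characteristic word.

Best approximation by convergents gives that `c` and `T^{q_n}(c)` agree on their first `q_{n+1} - 2`
letters. Hence, for `i < q_{n+1}`, the factor of length `q_n - 1` at `i` is the one at `i mod q_n`.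
So each factor of length `q_n - 1` occurs at a position below `q_n`; there are exactly `q_n` such
factors, so this position is unique (`eq_of_agree`). A Sturmian word is therefore coded by the
positions `ρ_n` of its prefixes of length `q_n - 1`, and the congruences express that these prefixes
are nested. The Ostrowski digits are the quotients of `ρ_{n+1}` by `q_n`. -/

namespace Sturmian

/-! ### Factors, counts of ones, complexity -/

/-- The number of letters `1` in the factor of length `n` of `x` at position `a`. -/
def ones (x : Word) (a n : ℕ) : ℕ := ∑ k ∈ Finset.range n, (x (a + k)).val

theorem length_factor (x : Word) (i n : ℕ) : (factor x i n).length = n := by simp [factor]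

theorem isFactor_factor (x : Word) (i n : ℕ) : IsFactor x (factor x i n) :=
  ⟨i, by rw [length_factor]⟩

theorem factor_eq_iff {x y : Word} {i j n : ℕ} :
    factor x i n = factor y j n ↔ ∀ k < n, x (i + k) = y (j + k) := by
  unfold factor
  rw [List.ofFn_inj, funext_iff]
  exact ⟨fun h k hk => h ⟨k, hk⟩, fun h k => h k k.2⟩

theorem factor_succ_left (x : Word) (i n : ℕ) :
    factor x i (n + 1) = x i :: factor x (i + 1) n := by
  simp only [factor, List.ofFn_succ]
  congr 2
  funext j
  simp only [Fin.val_succ]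
  congr 1
  omega

theorem factor_succ (x : Word) (i n : ℕ) :
    factor x i (n + 1) = factor x i n ++ [x (i + n)] := by
  simp only [factor, List.ofFn_succ', List.concat_eq_append]
  rfl

theorem dropLast_factor (x : Word) (i n : ℕ) : (factor x i (n + 1)).dropLast = factor x i n := by
  rw [factor_succ, List.dropLast_concat]

theorem ones_succ (x : Word) (a n : ℕ) : ones x a (n + 1) = ones x a n + (x (a + n)).val :=
  Finset.sum_range_succ _ _

theorem ones_add (x : Word) (a m n : ℕ) : ones x a (m + n) = ones x a m + ones x (a + m) n := by
  induction n with
  | zero => simp [ones]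
  | succ n ih => rw [← add_assoc, ones_succ, ih, ones_succ, add_assoc, add_assoc]

theorem ones_one (x : Word) (a : ℕ) : ones x a 1 = (x a).val := by simp [ones]

theorem ones_congr {x y : Word} {a b n : ℕ} (h : ∀ k < n, x (a + k) = y (b + k)) :
    ones x a n = ones y b n :=
  Finset.sum_congr rfl fun k hk => by rw [h k (Finset.mem_range.1 hk)]

theorem count_factor (x : Word) (a n : ℕ) : (factor x a n).count 1 = ones x a n := by
  induction n with
  | zero => simp [factor, ones]
  | succ n ih =>
    rw [factor_succ, List.count_append, ih, ones_succ]
    congr 1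
    generalize x (a + n) = e
    fin_cases e <;> rfl

theorem finite_factors (x : Word) (n : ℕ) : (Set.range fun i => factor x i n).Finite :=
  (List.finite_length_eq (Fin 2) n).subset (by rintro _ ⟨i, rfl⟩; exact length_factor x i n)

theorem complexity_zero (x : Word) : complexity x 0 = 1 := by
  have : (Set.range fun i => factor x i 0) = {[]} := by
    ext u
    simp [factor]
  rw [complexity, this, Set.ncard_singleton]

theorem IsSturmian.complexity_eq {x : Word} (h : IsSturmian x) (n : ℕ) :
    complexity x n = n + 1 := by
  rcases Nat.eq_zero_or_pos n with rfl | hn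
  · exact complexity_zero x
  · exact h n hn

/-! ### Eventually periodic words -/

/-- Factors whose length is a multiple of the period have a constant rational frequency of `1`s, at
a fixed distance from `α`. -/
theorem HasSlope.not_eventually_periodic {x : Word} {α : ℝ} (h : HasSlope x α)
    (hα : Irrational α) {N P : ℕ} (hP : 0 < P) (hper : ∀ k, x (N + k + P) = x (N + k)) :
    False := by
  have hblock : ∀ j, ones x (N + j * P) P = ones x N P := by
    intro j
    induction j with
    | zero => simp
    | succ j ih =>
      rw [← ih]
      apply ones_congr
      intro k _
      rw [add_assoc N (j * P) k, ← hper (j * P + k)]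
      congr 1
      ring
  have hmul : ∀ k, ones x N (k * P) = k * ones x N P := by
    intro k
    induction k with
    | zero => simp [ones]
    | succ k ih => rw [Nat.succ_mul, ones_add, ih, hblock, Nat.succ_mul]
  have hPR : (0 : ℝ) < P := by exact_mod_cast hP
  have hne : (ones x N P : ℝ) / P - α ≠ 0 := by
    intro h0
    apply hα
    exact ⟨(ones x N P : ℚ) / P, by push_cast; linarith⟩
  obtain ⟨M, hM⟩ := h _ (abs_pos.2 hne)
  have := hM (factor x N ((M + 1) * P)) (isFactor_factor _ _ _)
    (by rw [length_factor]; nlinarith)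
  rw [count_factor, length_factor, hmul] at this
  push_cast at this
  rw [mul_div_mul_left _ _ (by positivity)] at this
  exact lt_irrefl _ this

/-- The factor of length `n` of `x` at position `i` is right special. -/
def RightSpecialAt (x : Word) (n i : ℕ) : Prop :=
  ∃ b, factor x b n = factor x i n ∧ x (b + n) ≠ x (i + n)

theorem RightSpecialAt.congr {x : Word} {n i j : ℕ} (h : RightSpecialAt x n i)
    (hij : factor x i n = factor x j n) : RightSpecialAt x n j := by
  obtain ⟨b, hb, hne⟩ := h
  by_cases hc : x (b + n) = x (j + n)
  · exact ⟨i, hij, fun h => hne (hc.trans h.symm)⟩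
  · exact ⟨b, hb.trans hij, hc⟩

/-- Without right special factors the next letter is forced, so both occurrences continue alike.
Positions from `j` on copy those `j - i` earlier, so no right special factor ever appears. -/
theorem factor_eq_of_not_rightSpecial {x : Word} {n i j : ℕ} (hij : i < j)
    (heq : factor x i n = factor x j n) (hns : ∀ t, i ≤ t → t < j → ¬ RightSpecialAt x n t)
    (k : ℕ) : factor x (i + k) n = factor x (j + k) n ∧ ¬ RightSpecialAt x n (i + k) := by
  induction k using Nat.strong_induction_on with
  | _ k ih =>
    have h1 : factor x (i + k) n = factor x (j + k) n := by
      rcases k with _ | k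
      · exact heq
      · obtain ⟨he, hn⟩ := ih k (by omega)
        have hl : x (j + k + n) = x (i + k + n) := by
          by_contra hc
          exact hn ⟨j + k, he.symm, hc⟩
        have h2 : factor x (i + k) (n + 1) = factor x (j + k) (n + 1) := by
          rw [factor_succ, factor_succ, he, hl]
        rw [factor_succ_left, factor_succ_left] at h2
        exact (List.cons.inj h2).2
    refine ⟨h1, ?_⟩
    by_cases hk : k < j - i
    · exact hns _ (by omega) (by omega)
    · obtain ⟨he, hn⟩ := ih (k - (j - i)) (by omega)
      intro hr
      rw [show i + k = j + (k - (j - i)) by omega] at hr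
      exact hn (hr.congr he.symm)

theorem HasSlope.false_of_not_rightSpecial {x : Word} {α : ℝ} (h : HasSlope x α)
    (hα : Irrational α) {n i j : ℕ} (hij : i < j) (heq : factor x i n = factor x j n)
    (hns : ∀ t, i ≤ t → t < j → ¬ RightSpecialAt x n t) : False := by
  refine h.not_eventually_periodic hα (N := i + n) (P := j - i) (by omega) fun k => ?_
  obtain ⟨he, hn⟩ := factor_eq_of_not_rightSpecial hij heq hns k
  by_contra hc
  refine hn ⟨j + k, he.symm, fun h => hc ?_⟩
  convert h using 2 <;> omega

theorem HasSlope.exists_rightSpecialAt {x : Word} {α : ℝ} (h : HasSlope x α)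
    (hα : Irrational α) (n : ℕ) : ∃ i, RightSpecialAt x n i := by
  by_contra! hc
  have := (finite_factors x n).to_subtype
  obtain ⟨i, j, hne, heq⟩ := Finite.exists_ne_map_eq_of_infinite
    fun i : ℕ => (⟨factor x i n, i, rfl⟩ : Set.range fun i => factor x i n)
  have heq : factor x i n = factor x j n := congrArg Subtype.val heq
  rcases lt_or_gt_of_ne hne with hlt | hlt
  · exact h.false_of_not_rightSpecial hα hlt heq fun t _ _ => hc t
  · exact h.false_of_not_rightSpecial hα hlt heq.symm fun t _ _ => hc t

theorem dropLast_image (x : Word) (n : ℕ) :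
    List.dropLast '' (Set.range fun i => factor x i (n + 1)) = Set.range fun i => factor x i n := by
  rw [← Set.range_comp]
  congr 1
  funext i
  exact dropLast_factor x i n

/-- Deleting the last letter maps the factors of length `n + 1` onto those of length `n`, and a
right special factor has two preimages. -/
theorem HasSlope.complexity_lt {x : Word} {α : ℝ} (h : HasSlope x α)
    (hα : Irrational α) (n : ℕ) : complexity x n < complexity x (n + 1) := by
  by_contra! hc
  have h1 := Set.ncard_image_le (f := List.dropLast) (finite_factors x (n + 1))
  have hinj := Set.injOn_of_ncard_image_eq (f := List.dropLast)
    (le_antisymm h1 (by rw [dropLast_image]; exact hc)) (finite_factors x (n + 1))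
  obtain ⟨i, b, hb, hne⟩ := h.exists_rightSpecialAt hα n
  have := hinj ⟨b, rfl⟩ ⟨i, rfl⟩ (by simpa only [dropLast_factor] using hb)
  exact hne (factor_eq_iff.1 this n (by omega))

theorem HasSlope.lt_complexity {x : Word} {α : ℝ} (h : HasSlope x α)
    (hα : Irrational α) (n : ℕ) : n < complexity x n := by
  induction n with
  | zero => rw [complexity_zero]; exact one_pos
  | succ n ih => exact lt_of_le_of_lt ih (h.complexity_lt hα n)

/-! ### Sturmian words are balanced -/

theorem IsSturmian.factor_eq_of_rightSpecialAt {x : Word} (h : IsSturmian x) {n i j : ℕ}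
    (hi : RightSpecialAt x n i) (hj : RightSpecialAt x n j) : factor x i n = factor x j n := by
  by_contra hij
  set R := Set.range fun i => factor x i (n + 1) with hR
  have hdl : ∀ {a b}, factor x a (n + 1) = factor x b (n + 1) → factor x a n = factor x b n := by
    intro a b hab
    rw [← dropLast_factor, hab, dropLast_factor]
  have hne : factor x i (n + 1) ≠ factor x j (n + 1) := fun h => hij (hdl h)
  have hother : ∀ a b, RightSpecialAt x n a → factor x a n ≠ factor x b n →
      ∃ c, factor x c n = factor x a n ∧ factor x c (n + 1) ≠ factor x a (n + 1) ∧
        factor x c (n + 1) ≠ factor x b (n + 1) := by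
    rintro a b ⟨c, hc, hca⟩ hab
    exact ⟨c, hc, fun h => hca (factor_eq_iff.1 h n (by omega)),
      fun h => hab (hc.symm.trans (hdl h))⟩
  -- Given two distinct right special factors, discarding one extension of each leaves `n` words
  -- that still extend all `n + 1` factors of length `n`.
  have hsub : (Set.range fun i => factor x i n) ⊆
      List.dropLast '' (R \ {factor x i (n + 1), factor x j (n + 1)}) := by
    rintro _ ⟨k, rfl⟩
    suffices ∃ c, factor x c n = factor x k n ∧ factor x c (n + 1) ≠ factor x i (n + 1) ∧
        factor x c (n + 1) ≠ factor x j (n + 1) by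
      obtain ⟨c, h1, h2, h3⟩ := this
      exact ⟨factor x c (n + 1), ⟨⟨c, rfl⟩, by simp [h2, h3]⟩, by rw [dropLast_factor, h1]⟩
    by_cases hki : factor x k n = factor x i n
    · rw [hki]
      exact hother i j hi hij
    · by_cases hkj : factor x k n = factor x j n
      · rw [hkj]
        obtain ⟨c, h1, h2, h3⟩ := hother j i hj (Ne.symm hij)
        exact ⟨c, h1, h3, h2⟩
      · exact ⟨k, rfl, fun h => hki (hdl h), fun h => hkj (hdl h)⟩
  have hfin : (R \ {factor x i (n + 1), factor x j (n + 1)}).Finite :=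
    (finite_factors x (n + 1)).sdiff
  have h1 := (Set.ncard_le_ncard hsub (hfin.image _)).trans (Set.ncard_image_le hfin)
  have h2 : ({factor x i (n + 1), factor x j (n + 1)} : Set (List (Fin 2))) ⊆ R := by
    rintro _ (rfl | rfl)
    exacts [⟨i, rfl⟩, ⟨j, rfl⟩]
  have h3 := Set.ncard_sdiff_add_ncard_of_subset h2 (finite_factors x (n + 1))
  rw [Set.ncard_pair hne] at h3
  have h4 := h.complexity_eq n
  have h5 := h.complexity_eq (n + 1)
  change R.ncard = _ at h5
  rw [complexity] at h4
  omega

/-- A Sturmian word cannot contain both `awa` and `bwb` for a palindrome `w` of length `m` and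
letters `a ≠ b`, if `bw` is not right special. -/
theorem IsSturmian.false_of_unbalanced {x : Word} {α : ℝ} (h : IsSturmian x) (hs : HasSlope x α)
    (hα : Irrational α) {m i j : ℕ} (hij : x i ≠ x j)
    (hmid : ∀ k, 1 ≤ k → k ≤ m → x (i + k) = x (j + k))
    (hi : x (i + (m + 1)) = x i) (hj : x (j + (m + 1)) = x j)
    (hpal : ∀ k ≤ m + 1, x (i + k) = x (i + (m + 1 - k)))
    (hns : ¬ RightSpecialAt x (m + 1) j) : False := by
  -- `aw` cannot start inside the occurrence of `bwb`: the palindrome `awa` would turn the final `b`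
  -- into the letter at `j + t`, which is `a`.
  have hdisj : ∀ t ≤ m + 1, factor x (j + t) (m + 1) ≠ factor x i (m + 1) := by
    intro t ht heq
    rw [factor_eq_iff] at heq
    have h0 := heq 0 (by omega)
    simp only [add_zero] at h0
    by_cases ht0 : t = 0
    · subst ht0; exact hij h0.symm
    by_cases htm : t = m + 1
    · subst htm; exact hij (h0.symm.trans hj)
    have h1 := heq (m + 1 - t) (by omega)
    rw [show j + t + (m + 1 - t) = j + (m + 1) by omega, hj, ← hpal t ht,
      hmid t (by omega) (by omega), h0] at h1
    exact hij h1.symm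
  have hmid' : factor x (j + 1) m = factor x (i + 1) m := by
    rw [factor_eq_iff]
    intro k hk
    have := hmid (k + 1) (by omega) (by omega)
    rw [show j + 1 + k = j + (k + 1) by omega, show i + 1 + k = i + (k + 1) by omega, this]
  obtain ⟨r, hr⟩ := hs.exists_rightSpecialAt hα (m + 1)
  -- The tail of a right special factor is right special, hence is `w`; since `bw` is excluded, the
  -- factor is `aw`.
  have hri : factor x r (m + 1) = factor x i (m + 1) := by
    have hi1 : RightSpecialAt x m (i + 1) := by
      refine ⟨j + 1, hmid', ?_⟩
      rw [show j + 1 + m = j + (m + 1) by omega, show i + 1 + m = i + (m + 1) by omega, hi, hj]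
      exact hij.symm
    have hr1 : RightSpecialAt x m (r + 1) := by
      obtain ⟨b, hb, hne⟩ := hr
      rw [factor_succ_left, factor_succ_left] at hb
      refine ⟨b + 1, (List.cons.inj hb).2, ?_⟩
      rwa [show b + 1 + m = b + (m + 1) by omega, show r + 1 + m = r + (m + 1) by omega]
    have heq := h.factor_eq_of_rightSpecialAt hr1 hi1
    by_cases hx : x r = x i
    · rw [factor_succ_left, factor_succ_left, heq, hx]
    · exfalso
      have hx' : x r = x j := by
        generalize x r = a at *
        generalize x i = b at *
        generalize x j = c at *
        omega
      refine hns (hr.congr ?_)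
      rw [factor_succ_left, factor_succ_left, heq, hx', hmid']
  have hnst : ∀ t ≤ m + 1, ¬ RightSpecialAt x (m + 1) (j + t) := fun t ht hR =>
    hdisj t ht ((h.factor_eq_of_rightSpecialAt hR hr).trans hri)
  set R := Set.range fun i => factor x i (m + 1) with hR
  -- The `m + 2` positions in `bwb` carry only `m + 1` possible factors, so one repeats with no
  -- right special factor in between.
  have hcard : (R \ {factor x i (m + 1)}).ncard < (Set.Iic (m + 1)).ncard := by
    have h1 := Set.ncard_sdiff_singleton_add_one (s := R) (a := factor x i (m + 1)) ⟨i, rfl⟩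
      (finite_factors x (m + 1))
    have h2 := h.complexity_eq (m + 1)
    change R.ncard = _ at h2
    rw [← Finset.coe_Iic, Set.ncard_coe_finset, Nat.card_Iic]
    omega
  obtain ⟨s, hs', t, ht, hne, heq⟩ := Set.exists_ne_map_eq_of_ncard_lt_of_maps_to hcard
    (f := fun t => factor x (j + t) (m + 1))
    (fun t ht => ⟨⟨j + t, rfl⟩, hdisj t ht⟩) (finite_factors x (m + 1)).sdiff
  simp only [Set.mem_Iic] at hs' ht
  have key : ∀ s t, s < t → t ≤ m + 1 →
      factor x (j + s) (m + 1) = factor x (j + t) (m + 1) → False := by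
    intro s t hst ht heq
    refine hs.false_of_not_rightSpecial hα (by omega) heq fun u hu1 hu2 => ?_
    obtain ⟨v, rfl⟩ := Nat.exists_eq_add_of_le (show j ≤ u by omega)
    exact hnst v (by omega)
  rcases lt_or_gt_of_ne hne with hlt | hlt
  · exact key s t hlt ht heq
  · exact key t s hlt hs' heq.symm

/-- In a shortest counterexample every proper prefix and suffix has excess exactly `1`, so the two
factors are `0w0` and `1w1` with `w` a palindrome. By uniqueness `0w` and `1w` are not both right
special, so `false_of_unbalanced` applies. -/
theorem IsSturmian.balanced {x : Word} {α : ℝ} (h : IsSturmian x) (hs : HasSlope x α)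
    (hα : Irrational α) (n : ℕ) : ∀ i j, ones x j n ≤ ones x i n + 1 := by
  induction n using Nat.strong_induction_on with
  | _ n ih =>
    intro i j
    by_contra! hc
    obtain ⟨m, rfl⟩ : ∃ m, n = m + 2 := by
      rcases n with _ | _ | m
      · simp [ones] at hc
      · simp only [zero_add, ones_one] at hc
        omega
      · exact ⟨m, rfl⟩
    have hsplit : ∀ a l, l ≤ m + 2 →
        ones x a (m + 2) = ones x a l + ones x (a + l) (m + 2 - l) := by
      intro a l hl
      rw [← ones_add]
      congr 1
      omega
    have hE : ∀ l, 1 ≤ l → l < m + 2 → ones x j l = ones x i l + 1 := by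
      intro l h1 h2
      have e1 := ih l h2 i j
      have e2 := ih (m + 2 - l) (by omega) (i + l) (j + l)
      have e3 := hsplit i l h2.le
      have e4 := hsplit j l h2.le
      omega
    have hF : ∀ l, 1 ≤ l → l < m + 2 →
        ones x (j + (m + 2 - l)) l = ones x (i + (m + 2 - l)) l + 1 := by
      intro l h1 h2
      have e1 := ih l h2 (i + (m + 2 - l)) (j + (m + 2 - l))
      have e2 := ih (m + 2 - l) (by omega) i j
      have e3 := hsplit i (m + 2 - l) (by omega)
      have e4 := hsplit j (m + 2 - l) (by omega)
      rw [show m + 2 - (m + 2 - l) = l by omega] at e3 e4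
      omega
    -- Comparing a prefix of one factor with a suffix of the other, both ways, gives the palindromic
    -- symmetry.
    have hG : ∀ l, l < m + 2 → ones x (i + (m + 2 - l)) l = ones x i l := by
      intro l h2
      rcases Nat.eq_zero_or_pos l with rfl | h1
      · simp [ones]
      have e1 := ih l h2 i (j + (m + 2 - l))
      have e2 := ih l h2 (i + (m + 2 - l)) j
      have e3 := hE l h1 h2
      have e4 := hF l h1 h2
      omega
    have hfirst : (x j).val = (x i).val + 1 := by
      have := hE 1 le_rfl (by omega)
      rwa [ones_one, ones_one] at this
    have hlast : (x (j + (m + 1))).val = (x (i + (m + 1))).val + 1 := by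
      have e1 := hF 1 le_rfl (by omega)
      rwa [ones_one, ones_one] at e1
    have hmid : ∀ k, 1 ≤ k → k ≤ m → x (i + k) = x (j + k) := by
      intro k h1 h2
      have e1 := hE k h1 (by omega)
      have e2 := hE (k + 1) (by omega) (by omega)
      rw [ones_succ, ones_succ] at e2
      apply Fin.ext
      omega
    have hpal : ∀ k ≤ m + 1, x (i + k) = x (i + (m + 1 - k)) := by
      have key : ∀ k < m + 1, x (i + k) = x (i + (m + 1 - k)) := by
        intro k hk
        have e1 := hG k (by omega)
        have e2 := hG (k + 1) (by omega)
        rw [ones_succ x i k, add_comm k 1, ones_add, ones_one,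
          show i + (m + 2 - (1 + k)) + 1 = i + (m + 2 - k) by omega,
          show i + (m + 2 - (1 + k)) = i + (m + 1 - k) by omega] at e2
        apply Fin.ext
        omega
      intro k hk
      rcases Nat.eq_zero_or_pos (m + 1 - k) with h0 | h0
      · rw [show k = m + 1 by omega, Nat.sub_self, key 0 (by omega)]
        rfl
      · exact key k (by omega)
    have hi : x (i + (m + 1)) = x i := (hpal 0 (by omega)).symm
    have hj : x (j + (m + 1)) = x j := by
      apply Fin.ext
      rw [hlast, hfirst, hi]
    have hij : x i ≠ x j := fun he => by rw [he] at hfirst; omega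
    have hpal' : ∀ k ≤ m + 1, x (j + k) = x (j + (m + 1 - k)) := by
      intro k hk
      by_cases h0 : k = 0
      · subst h0; exact hj.symm
      by_cases h1 : k = m + 1
      · subst h1; simpa using hj
      rw [← hmid k (by omega) (by omega), ← hmid (m + 1 - k) (by omega) (by omega), hpal k hk]
    by_cases hr : RightSpecialAt x (m + 1) j
    · refine h.false_of_unbalanced hs hα hij.symm (fun k h1 h2 => (hmid k h1 h2).symm) hj hi hpal'
        fun hr' => hij ?_
      exact factor_eq_iff.1 (h.factor_eq_of_rightSpecialAt hr' hr) 0 (by omega)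
    · exact h.false_of_unbalanced hs hα hij hmid hi hj hpal hr


/-! ### The language of the Sturmian words of a given slope -/

/-- In every factor of `x` the number of `1`s differs from its expected value by less than `1`. -/
def IsBalancedWithSlope (x : Word) (α : ℝ) : Prop :=
  ∀ a n, |(ones x a n : ℝ) - α * n| < 1

/-- The words all of whose factors contain `1` with frequency almost `α`. -/
def slopeLanguage (α : ℝ) : Set (List (Fin 2)) :=
  {u | ∀ v, v <:+: u → |(v.count 1 : ℝ) - α * v.length| < 1}

/-- Cut a long prefix into blocks of length `n`, whose counts differ by at most `1` from that of the
given factor. The frequency limit gives the bound `≤ 1`, and irrationality makes it strict. -/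
theorem IsSturmian.isBalancedWithSlope {x : Word} {α : ℝ} (h : IsSturmian x) (hs : HasSlope x α)
    (hα : Irrational α) : IsBalancedWithSlope x α := by
  intro a n
  rcases Nat.eq_zero_or_pos n with rfl | hn
  · simp [ones]
  have hnR : (0 : ℝ) < n := by exact_mod_cast hn
  have hb := h.balanced hs hα n
  have hup : ∀ k, ones x 0 (k * n) ≤ k * (ones x a n + 1) := by
    intro k
    induction k with
    | zero => simp [ones]
    | succ k ih =>
      rw [Nat.succ_mul, ones_add, Nat.succ_mul]
      exact add_le_add ih (hb _ _)
  have hlow : ∀ k, k * ones x a n ≤ ones x 0 (k * n) + k := by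
    intro k
    induction k with
    | zero => simp [ones]
    | succ k ih =>
      rw [Nat.succ_mul, Nat.succ_mul, ones_add]
      have := hb (0 + k * n) a
      omega
  have hclose : ∀ ε : ℝ, 0 < ε → |(ones x a n : ℝ) / n - α| ≤ 1 / n + ε := by
    intro ε hε
    obtain ⟨M, hM⟩ := hs ε hε
    have h1 := hM (factor x 0 ((M + 1) * n)) (isFactor_factor _ _ _)
      (by rw [length_factor]; nlinarith)
    rw [count_factor, length_factor, abs_lt] at h1
    have hu : (ones x 0 ((M + 1) * n) : ℝ) ≤ (M + 1) * (ones x a n + 1) := by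
      exact_mod_cast hup (M + 1)
    have hl : ((M : ℝ) + 1) * ones x a n ≤ ones x 0 ((M + 1) * n) + (M + 1) := by
      exact_mod_cast hlow (M + 1)
    have hMR : (0 : ℝ) < M + 1 := by positivity
    push_cast at h1
    have e1 : (ones x 0 ((M + 1) * n) : ℝ) / ((M + 1) * n) ≤ ones x a n / n + 1 / n := by
      rw [← add_div, div_le_div_iff₀ (by positivity) hnR]
      nlinarith
    have e2 : (ones x a n : ℝ) / n ≤ ones x 0 ((M + 1) * n) / ((M + 1) * n) + 1 / n := by
      rw [div_add_div _ _ (by positivity) hnR.ne', div_le_div_iff₀ hnR (by positivity)]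
      nlinarith [mul_le_mul_of_nonneg_right hl (by positivity : (0 : ℝ) ≤ n * n)]
    rw [abs_le]
    constructor <;> linarith [h1.1, h1.2]
  have hle : |(ones x a n : ℝ) - α * n| ≤ 1 := by
    have := le_of_forall_pos_le_add hclose
    have e : (ones x a n : ℝ) - α * n = (ones x a n / n - α) * n := by field_simp
    rw [e, abs_mul, abs_of_pos hnR]
    calc _ ≤ 1 / (n : ℝ) * n := by gcongr
      _ = 1 := by field_simp
  refine lt_of_le_of_ne hle fun he => ?_
  have hirr : Irrational (α * n) := hα.mul_natCast hn.ne'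
  rcases (abs_eq one_pos.le).1 he with h1 | h1
  · exact hirr ⟨ones x a n - 1, by push_cast; linarith⟩
  · exact hirr ⟨ones x a n + 1, by push_cast; linarith⟩

theorem IsBalancedWithSlope.hasSlope {x : Word} {α : ℝ} (h : IsBalancedWithSlope x α) :
    HasSlope x α := by
  intro ε hε
  obtain ⟨N, hN⟩ := exists_nat_gt (1 / ε)
  refine ⟨N, ?_⟩
  rintro u ⟨i, hu⟩ hlen
  have h1 := h i u.length
  rw [← count_factor, ← hu] at h1
  have hR : 1 / ε < u.length := hN.trans_le (by exact_mod_cast hlen)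
  have hpos : (0 : ℝ) < u.length := (by positivity : 0 < 1 / ε).trans hR
  rw [div_sub' hpos.ne', abs_div, abs_of_pos hpos, div_lt_iff₀ hpos]
  rw [div_lt_iff₀ hε] at hR
  rw [mul_comm _ α]
  linarith

theorem exists_factor_of_infix {x : Word} {i n : ℕ} {v : List (Fin 2)}
    (h : v <:+: factor x i n) : ∃ j, v = factor x j v.length := by
  obtain ⟨s, t, hst⟩ := h
  refine ⟨i + s.length, List.ext_getElem (by rw [length_factor]) fun k h1 h2 => ?_⟩
  have hlen : s.length + v.length + t.length = n := by
    have := congrArg List.length hst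
    simpa [length_factor, add_assoc] using this
  have h3 : (s ++ v ++ t)[s.length + k]'(by simp; omega) = v[k] := by
    rw [List.getElem_append_left (by simp; omega), List.getElem_append_right (by omega)]
    simp
  rw [← h3]
  simp only [hst]
  simp [factor, add_assoc]

theorem IsBalancedWithSlope.factor_mem {x : Word} {α : ℝ} (h : IsBalancedWithSlope x α)
    (i n : ℕ) : factor x i n ∈ slopeLanguage α := by
  intro v hv
  obtain ⟨j, hj⟩ := exists_factor_of_infix hv
  rw [hj, count_factor, length_factor]
  exact h j _

theorem slopeLanguage_of_infix {α : ℝ} {u v : List (Fin 2)} (hu : u ∈ slopeLanguage α)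
    (hv : v <:+: u) : v ∈ slopeLanguage α := fun w hw => hu w (hw.trans hv)

theorem exists_first_difference {u v : List (Fin 2)} (hlen : u.length = v.length) (hne : u ≠ v) :
    ∃ w a b s t, a ≠ b ∧ u = w ++ a :: s ∧ v = w ++ b :: t := by
  induction u generalizing v with
  | nil => exact absurd (List.length_eq_zero_iff.1 hlen.symm).symm hne
  | cons c u ih =>
    rcases v with _ | ⟨d, v⟩
    · simp at hlen
    by_cases hcd : c = d
    · subst hcd
      obtain ⟨w, a, b, s, t, hab, rfl, rfl⟩ := ih (v := v) (by simpa using hlen)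
        (fun h => hne (by rw [h]))
      exact ⟨c :: w, a, b, s, t, hab, rfl, rfl⟩
    · exact ⟨[], c, d, u, v, hcd, rfl, rfl⟩

/-- There is at most one left special word of each length. -/
theorem slopeLanguage_leftSpecial_unique {α : ℝ} {u v : List (Fin 2)}
    (hlen : u.length = v.length) (hu : ∀ a, a :: u ∈ slopeLanguage α)
    (hv : ∀ a, a :: v ∈ slopeLanguage α) : u = v := by
  -- The words `0w0` and `1w1` have counts differing by `2`, yet both would be within less than `1`
  -- of the same number.
  have key : ∀ w s t : List (Fin 2), 0 :: (w ++ 0 :: s) ∈ slopeLanguage α →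
      1 :: (w ++ 1 :: t) ∈ slopeLanguage α → False := by
    intro w s t h0 h1
    have e0 := h0 (0 :: (w ++ [0])) ⟨[], s, by simp⟩
    have e1 := h1 (1 :: (w ++ [1])) ⟨[], t, by simp⟩
    simp only [List.count_cons, List.count_append, List.length_cons, List.length_append] at e0 e1
    rw [abs_lt] at e0 e1
    simp at e0 e1
    linarith [e0.1, e1.2]
  by_contra hne
  obtain ⟨w, a, b, s, t, hab, rfl, rfl⟩ := exists_first_difference hlen hne
  fin_cases a <;> fin_cases b
  · exact hab rfl
  · exact key w s t (hu 0) (hv 1)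
  · exact key w t s (hv 0) (hu 1)
  · exact hab rfl

theorem finite_slopeLanguage (α : ℝ) (n : ℕ) : {u ∈ slopeLanguage α | u.length = n}.Finite :=
  (List.finite_length_eq (Fin 2) n).subset fun _ h => h.2

/-- Removing the first letter is injective except over the at most one left special word, so the
count grows by at most `1`. -/
theorem ncard_slopeLanguage_le (α : ℝ) (n : ℕ) :
    {u ∈ slopeLanguage α | u.length = n}.ncard ≤ n + 1 := by
  induction n with
  | zero =>
    refine (Set.ncard_le_ncard (t := {[]}) ?_).trans (by simp)
    rintro u ⟨-, hu⟩
    exact List.length_eq_zero_iff.1 hu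
  | succ n ih =>
    set B := {u ∈ slopeLanguage α | u.length = n} with hB
    have hfin : B.Finite := finite_slopeLanguage α n
    let X : Fin 2 → Set (List (Fin 2)) := fun a => {u | a :: u ∈ slopeLanguage α ∧ u.length = n}
    have hX : ∀ a, X a ⊆ B := fun a u hu =>
      ⟨slopeLanguage_of_infix hu.1 (List.suffix_cons a u).isInfix, hu.2⟩
    have hsub : {u ∈ slopeLanguage α | u.length = n + 1} ⊆
        List.cons 0 '' X 0 ∪ List.cons 1 '' X 1 := by
      rintro u ⟨hu, hlen⟩
      rcases u with _ | ⟨a, u⟩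
      · simp at hlen
      have hlen' : u.length = n := by simpa using hlen
      fin_cases a
      · exact Or.inl ⟨u, ⟨hu, hlen'⟩, rfl⟩
      · exact Or.inr ⟨u, ⟨hu, hlen'⟩, rfl⟩
    have f0 := hfin.subset (hX 0)
    have f1 := hfin.subset (hX 1)
    have h1 : (X 0 ∩ X 1).ncard ≤ 1 := by
      rw [Set.ncard_le_one (f0.inter_of_left _)]
      rintro u ⟨hu0, hu1⟩ v ⟨hv0, hv1⟩
      refine slopeLanguage_leftSpecial_unique (α := α) (hu0.2.trans hv0.2.symm) (fun a => ?_) fun a => ?_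
      · fin_cases a
        exacts [hu0.1, hu1.1]
      · fin_cases a
        exacts [hv0.1, hv1.1]
    calc _ ≤ _ := Set.ncard_le_ncard hsub ((f0.image _).union (f1.image _))
      _ ≤ _ := Set.ncard_union_le _ _
      _ ≤ (X 0).ncard + (X 1).ncard := add_le_add (Set.ncard_image_le f0) (Set.ncard_image_le f1)
      _ = (X 0 ∪ X 1).ncard + (X 0 ∩ X 1).ncard := (Set.ncard_union_add_ncard_inter _ _ f0 f1).symm
      _ ≤ B.ncard + 1 := add_le_add (Set.ncard_le_ncard (Set.union_subset (hX 0) (hX 1)) hfin) h1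
      _ ≤ n + 1 + 1 := by omega

theorem IsBalancedWithSlope.range_factor {x : Word} {α : ℝ} (h : IsBalancedWithSlope x α)
    (hα : Irrational α) (n : ℕ) :
    (Set.range fun i => factor x i n) = {u ∈ slopeLanguage α | u.length = n} := by
  refine Set.eq_of_subset_of_ncard_le ?_ ?_ (finite_slopeLanguage α n)
  · rintro _ ⟨i, rfl⟩
    exact ⟨h.factor_mem i n, length_factor x i n⟩
  · exact (ncard_slopeLanguage_le α n).trans (h.hasSlope.lt_complexity hα n)

theorem IsBalancedWithSlope.isSturmian {x : Word} {α : ℝ} (h : IsBalancedWithSlope x α)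
    (hα : Irrational α) : IsSturmian x := by
  intro n _
  refine le_antisymm ?_ (h.hasSlope.lt_complexity hα n)
  rw [complexity, h.range_factor hα]
  exact ncard_slopeLanguage_le α n

theorem isBalancedWithSlope_iff {x : Word} {α : ℝ} (hα : Irrational α) :
    IsBalancedWithSlope x α ↔ IsSturmian x ∧ HasSlope x α :=
  ⟨fun h => ⟨h.isSturmian hα, h.hasSlope⟩, fun h => h.1.isBalancedWithSlope h.2 hα⟩

theorem IsBalancedWithSlope.isFactor_iff {x : Word} {α : ℝ} (h : IsBalancedWithSlope x α)
    (hα : Irrational α) {u : List (Fin 2)} : IsFactor x u ↔ u ∈ slopeLanguage α := by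
  have := Set.ext_iff.1 (h.range_factor hα u.length) u
  simp only [Set.mem_range, Set.mem_ofPred_eq, and_true] at this
  rw [← this, IsFactor]
  simp only [eq_comm]

/-! ### The characteristic word -/

open Classical in
/-- The characteristic word of slope `α` as a mechanical word:
its `j`-th letter is `⌊α (j + 1)⌋ - ⌊α j⌋`, for `j ≥ 1`. -/
noncomputable def mechanicalWord (α : ℝ) : Word := fun k =>
  if ⌊α * (k + 2)⌋ = ⌊α * (k + 1)⌋ then 0 else 1

theorem mechanicalWord_val {α : ℝ} (hα₀ : 0 < α) (hα₁ : α < 1) (k : ℕ) :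
    ((mechanicalWord α k).val : ℤ) = ⌊α * (k + 2)⌋ - ⌊α * (k + 1)⌋ := by
  unfold mechanicalWord
  split_ifs with h
  · simp [h]
  · have h1 : ⌊α * (k + 1)⌋ ≤ ⌊α * (k + 2)⌋ := Int.floor_le_floor (by nlinarith)
    have h2 : ⌊α * (k + 2)⌋ ≤ ⌊α * (k + 1)⌋ + 1 := by
      rw [← Int.floor_add_one]
      exact Int.floor_le_floor (by nlinarith)
    have : ((1 : Fin 2).val : ℤ) = 1 := rfl
    omega

theorem ones_mechanicalWord {α : ℝ} (hα₀ : 0 < α) (hα₁ : α < 1) (a n : ℕ) :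
    (ones (mechanicalWord α) a n : ℤ) = ⌊α * (a + n + 1)⌋ - ⌊α * (a + 1)⌋ := by
  induction n with
  | zero => simp [ones]
  | succ n ih =>
    rw [ones_succ]
    push_cast
    rw [ih, mechanicalWord_val hα₀ hα₁]
    push_cast
    rw [show (a : ℝ) + n + 2 = a + (n + 1) + 1 by ring]
    ring

/-- The word `e c` for a letter `e` and a word `c`. -/
def consWord (e : Fin 2) (c : Word) : Word
  | 0 => e
  | k + 1 => c k

/-- The discrepancy of a nonempty prefix is `e` minus a fractional part, that of any later factor a
difference of two fractional parts. For `e = 1` the fractional part must be nonzero, hence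
irrationality. -/
theorem isBalancedWithSlope_consWord {α : ℝ} (hα : Irrational α) (hα₀ : 0 < α) (hα₁ : α < 1)
    (e : Fin 2) : IsBalancedWithSlope (consWord e (mechanicalWord α)) α := by
  have hcons : ∀ a n, ones (consWord e (mechanicalWord α)) (a + 1) n =
      ones (mechanicalWord α) a n := fun a n => ones_congr fun k _ => by
    rw [show a + 1 + k = (a + k) + 1 by omega]
    rfl
  have hlt : ∀ n : ℕ, (⌊α * (n + 1)⌋ : ℝ) < α * (n + 1) := fun n =>
    lt_of_le_of_ne (Int.floor_le _) fun h => by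
      have : Irrational (α * (n + 1 : ℕ)) := hα.mul_natCast n.succ_ne_zero
      exact this ⟨⌊α * (n + 1)⌋, by push_cast; exact h⟩
  intro a n
  rcases a with _ | a
  · rcases n with _ | n
    · simp [ones]
    · have h1 : ones (consWord e (mechanicalWord α)) 0 (n + 1) =
          e.val + ones (mechanicalWord α) 0 n := by
        rw [add_comm n 1, ones_add, ones_one, hcons]
        rfl
      have h2 := ones_mechanicalWord hα₀ hα₁ 0 n
      have h3 : ⌊α * ((0 : ℕ) + 1)⌋ = 0 := by
        rw [Int.floor_eq_zero_iff]
        constructor <;> simp <;> linarith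
      rw [h3, sub_zero] at h2
      have h4 : (ones (mechanicalWord α) 0 n : ℝ) = (⌊α * (n + 1)⌋ : ℤ) := by
        rw [← Int.cast_natCast, h2]
        simp
      have h5 := hlt n
      have h6 := Int.lt_floor_add_one (α * (n + 1))
      have h7 : (e.val : ℝ) ≤ 1 := by exact_mod_cast Nat.le_of_lt_succ e.2
      have h8 : (0 : ℝ) ≤ e.val := Nat.cast_nonneg _
      rw [h1, abs_lt]
      push_cast
      rw [h4]
      constructor <;> linarith
  · rw [hcons]
    have h2 := ones_mechanicalWord hα₀ hα₁ a n
    have h4 : (ones (mechanicalWord α) a n : ℝ) =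
        (⌊α * (a + n + 1)⌋ : ℝ) - (⌊α * (a + 1)⌋ : ℝ) := by
      exact_mod_cast h2
    have h5 := hlt a
    have h6 := hlt (a + n)
    have h7 := Int.lt_floor_add_one (α * (a + 1))
    have h8 := Int.lt_floor_add_one (α * (a + n + 1))
    push_cast at h6
    rw [h4, abs_lt]
    constructor <;> nlinarith

theorem firstLetters_injective {x y : Word}
    (h : ∀ n, 1 ≤ n → firstLetters x n = firstLetters y n) : x = y := by
  funext k
  have := factor_eq_iff.1 (h (k + 1) (by omega)) k (by omega)
  simpa using this

theorem isBalancedWithSlope_mechanicalWord {α : ℝ} (hα : Irrational α) (hα₀ : 0 < α)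
    (hα₁ : α < 1) : IsBalancedWithSlope (mechanicalWord α) α := by
  intro a n
  have h := isBalancedWithSlope_consWord hα hα₀ hα₁ 0 (a + 1) n
  rwa [ones_congr (y := mechanicalWord α) (b := a) fun k _ => by
    rw [show a + 1 + k = (a + k) + 1 by omega]; rfl] at h

theorem cons_firstLetters_mechanicalWord_mem {α : ℝ} (hα : Irrational α) (hα₀ : 0 < α)
    (hα₁ : α < 1) (n : ℕ) (e : Fin 2) :
    e :: firstLetters (mechanicalWord α) n ∈ slopeLanguage α := by
  have h := (isBalancedWithSlope_consWord hα hα₀ hα₁ e).factor_mem 0 (n + 1)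
  rw [factor_succ_left] at h
  have hf : firstLetters (mechanicalWord α) n = factor (consWord e (mechanicalWord α)) (0 + 1) n :=
    factor_eq_iff.2 fun k _ => by
      rw [zero_add, zero_add, add_comm]
      rfl
  rw [hf]
  exact h

/-- Prefixes of a characteristic word are left special in the mechanical word itself, and there is
only one left special word of each length. -/
theorem isCharacteristic_iff {α : ℝ} (hα : Irrational α) (hα₀ : 0 < α) (hα₁ : α < 1) {c : Word} :
    IsCharacteristic α c ↔ c = mechanicalWord α := by
  have hbal := isBalancedWithSlope_mechanicalWord hα hα₀ hα₁
  have hmem := cons_firstLetters_mechanicalWord_mem hα hα₀ hα₁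
  constructor
  · intro h
    refine firstLetters_injective fun n hn => ?_
    have hls := h.2.2 _ (hbal.isSturmian hα) hbal.hasSlope n hn
    rw [IsLeftSpecial, hbal.isFactor_iff hα, hbal.isFactor_iff hα] at hls
    refine slopeLanguage_leftSpecial_unique (by simp [firstLetters, length_factor])
      (fun a => ?_) (hmem n)
    fin_cases a
    exacts [hls.1, hls.2]
  · rintro rfl
    refine ⟨hbal.isSturmian hα, hbal.hasSlope, fun x hx hs n _ => ?_⟩
    have hx := hx.isBalancedWithSlope hs hα
    exact ⟨(hx.isFactor_iff hα).2 (hmem n 0), (hx.isFactor_iff hα).2 (hmem n 1)⟩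

theorem characteristicWord_eq {α : ℝ} (hα : Irrational α) (hα₀ : 0 < α) (hα₁ : α < 1) :
    characteristicWord α = mechanicalWord α :=
  (isCharacteristic_iff hα hα₀ hα₁).1
    (Classical.epsilon_spec ⟨_, (isCharacteristic_iff hα hα₀ hα₁).2 rfl⟩)


/-! ### Continued fractions -/

/-- The complete remainders `ξ₀ = α`, `ξ_{n+1} = {1 / ξ_n}` of `α`. -/
noncomputable def remainder (α : ℝ) (n : ℕ) : ℝ := (fun t => Int.fract t⁻¹)^[n] α

theorem remainder_succ (α : ℝ) (n : ℕ) : remainder α (n + 1) = Int.fract (remainder α n)⁻¹ :=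
  Function.iterate_succ_apply' _ _ _

theorem irrational_fract {t : ℝ} (h : Irrational t) : Irrational (Int.fract t) :=
  h.sub_intCast _

theorem irrational_remainder {α : ℝ} (hα : Irrational α) (n : ℕ) : Irrational (remainder α n) := by
  induction n with
  | zero => exact hα
  | succ n ih => rw [remainder_succ]; exact irrational_fract ih.inv

theorem remainder_lt_one {α : ℝ} (hα₁ : α < 1) (n : ℕ) : remainder α n < 1 := by
  rcases n with _ | n
  · exact hα₁
  · rw [remainder_succ]; exact Int.fract_lt_one _

theorem remainder_pos {α : ℝ} (hα : Irrational α) (hα₀ : 0 < α) (n : ℕ) : 0 < remainder α n := by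
  rcases n with _ | n
  · exact hα₀
  · refine lt_of_le_of_ne ?_ (irrational_remainder hα _).ne_zero.symm
    rw [remainder_succ]
    exact Int.fract_nonneg _

theorem of_s_get? {v : ℝ} (hv : Irrational v) (n : ℕ) :
    (GenContFract.of v).s.get? n = some ⟨1, (⌊(remainder (Int.fract v) n)⁻¹⌋ : ℤ)⟩ := by
  induction n generalizing v with
  | zero => exact GenContFract.of_s_head (irrational_fract hv).ne_zero
  | succ n ih =>
    rw [GenContFract.of_s_succ, ih (irrational_fract hv).inv]
    rfl

theorem partialQuotient_eq {α : ℝ} (hα : Irrational α) (hα₀ : 0 < α) (hα₁ : α < 1) (n : ℕ) :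
    (partialQuotient α n : ℤ) = ⌊(remainder α n)⁻¹⌋ := by
  have h := of_s_get? hα n
  rw [Int.fract_eq_self.2 ⟨hα₀.le, hα₁⟩] at h
  rw [partialQuotient, GenContFract.partDen_eq_s_b h, Option.getD_some, ← Int.natCast_floor_eq_floor,
    Int.cast_natCast, Nat.floor_natCast]
  exact inv_nonneg.2 (remainder_pos hα hα₀ n).le

theorem remainder_succ_eq {α : ℝ} (hα : Irrational α) (hα₀ : 0 < α) (hα₁ : α < 1) (n : ℕ) :
    remainder α (n + 1) = (remainder α n)⁻¹ - partialQuotient α n := by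
  rw [remainder_succ, Int.fract, ← partialQuotient_eq hα hα₀ hα₁, Int.cast_natCast]

theorem one_le_partialQuotient {α : ℝ} (hα : Irrational α) (hα₀ : 0 < α) (hα₁ : α < 1) (n : ℕ) :
    1 ≤ partialQuotient α n := by
  have h : (1 : ℤ) ≤ partialQuotient α n := by
    rw [partialQuotient_eq hα hα₀ hα₁, Int.le_floor, Int.cast_one]
    exact (one_le_inv₀ (remainder_pos hα hα₀ n)).2 (remainder_lt_one hα₁ n).le
  exact_mod_cast h

theorem continuant_pos {α : ℝ} (hα : Irrational α) (hα₀ : 0 < α) (hα₁ : α < 1) :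
    ∀ n, 0 < continuant α n
  | 0 => one_pos
  | 1 => one_le_partialQuotient hα hα₀ hα₁ 0
  | n + 2 => by
    rw [continuant]
    exact Nat.add_pos_right _ (continuant_pos hα hα₀ hα₁ n)

theorem continuant_add_le {α : ℝ} (hα : Irrational α) (hα₀ : 0 < α) (hα₁ : α < 1) (n : ℕ) :
    continuant α (n + 1) + continuant α n ≤ continuant α (n + 2) := by
  rw [continuant]
  have := Nat.le_mul_of_pos_left (continuant α (n + 1)) (one_le_partialQuotient hα hα₀ hα₁ (n + 1))
  omega

theorem continuant_mono {α : ℝ} (hα : Irrational α) (hα₀ : 0 < α) (hα₁ : α < 1) :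
    Monotone (continuant α) := by
  refine monotone_nat_of_le_succ fun n => ?_
  rcases n with _ | n
  · exact continuant_pos hα hα₀ hα₁ 1
  · exact (Nat.le_add_right _ _).trans (continuant_add_le hα hα₀ hα₁ n)

theorem le_continuant {α : ℝ} (hα : Irrational α) (hα₀ : 0 < α) (hα₁ : α < 1) :
    ∀ n, n ≤ continuant α n
  | 0 => Nat.zero_le _
  | 1 => continuant_pos hα hα₀ hα₁ 1
  | n + 2 => by
    have h1 := le_continuant hα hα₀ hα₁ (n + 1)
    have h2 := continuant_pos hα hα₀ hα₁ n
    have h3 := continuant_add_le hα hα₀ hα₁ n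
    omega

/-- The numerators of the convergents of `α`. -/
noncomputable def numerator (α : ℝ) : ℕ → ℕ
  | 0 => 0
  | 1 => 1
  | n + 2 => partialQuotient α (n + 1) * numerator α (n + 1) + numerator α n

theorem continuant_mul_numerator_sub (α : ℝ) (n : ℕ) :
    (continuant α n * numerator α (n + 1) - numerator α n * continuant α (n + 1) : ℤ) =
      (-1) ^ n := by
  induction n with
  | zero => simp [continuant, numerator]
  | succ n ih =>
    rw [continuant, numerator, pow_succ, ← ih]
    push_cast
    ring

theorem continuant_mul_sub_numerator {α : ℝ} (hα : Irrational α) (hα₀ : 0 < α) (hα₁ : α < 1) :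
    ∀ n, (continuant α n * α - numerator α n : ℝ) =
      (-1) ^ n * ∏ i ∈ Finset.range (n + 1), remainder α i
  | 0 => by simp [continuant, numerator, remainder]
  | 1 => by
    rw [Finset.prod_range_succ, remainder_succ_eq hα hα₀ hα₁]
    simp only [continuant, numerator, Finset.prod_range_one, remainder,
      Function.iterate_zero, id_eq]
    push_cast
    field_simp
    ring
  | n + 2 => by
    have h0 := continuant_mul_sub_numerator hα hα₀ hα₁ n
    have h1 := continuant_mul_sub_numerator hα hα₀ hα₁ (n + 1)
    have hr := (remainder_pos hα hα₀ (n + 1)).ne'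
    have hs : remainder α (n + 1) * remainder α (n + 2) =
        1 - partialQuotient α (n + 1) * remainder α (n + 1) := by
      rw [remainder_succ_eq hα hα₀ hα₁ (n + 1)]
      field_simp
    rw [Finset.prod_range_succ] at h1
    rw [continuant, numerator, Finset.prod_range_succ, Finset.prod_range_succ, mul_assoc, hs]
    push_cast
    rw [pow_succ] at h1 ⊢
    linear_combination (partialQuotient α (n + 1) : ℝ) * h1 + h0

/-- The convergents of `α` are best approximations. -/
theorem abs_continuant_mul_sub_le {α : ℝ} (hα : Irrational α) (hα₀ : 0 < α) (hα₁ : α < 1)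
    {n m : ℕ} (hm : 0 < m) (hmq : m < continuant α (n + 1)) (k : ℤ) :
    |continuant α n * α - numerator α n| ≤ |m * α - k| := by
  have hdet := continuant_mul_numerator_sub α n
  have hε : ((-1 : ℤ) ^ n) * (-1) ^ n = 1 := by rw [← mul_pow]; simp
  have hn := continuant_mul_sub_numerator hα hα₀ hα₁ n
  have hn1 := continuant_mul_sub_numerator hα hα₀ hα₁ (n + 1)
  have hprod : ∀ N, 0 < ∏ i ∈ Finset.range N, remainder α i := fun N =>
    Finset.prod_pos fun i _ => remainder_pos hα hα₀ i
  have hD := hprod (n + 1)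
  have hD1 := hprod (n + 1 + 1)
  set D := ∏ i ∈ Finset.range (n + 1), remainder α i
  set D1 := ∏ i ∈ Finset.range (n + 1 + 1), remainder α i
  set q := (continuant α n : ℤ)
  set q1 := (continuant α (n + 1) : ℤ)
  set p := (numerator α n : ℤ)
  set p1 := (numerator α (n + 1) : ℤ)
  have hqpos : 0 < q := Int.natCast_pos.2 (continuant_pos hα hα₀ hα₁ n)
  have hmpos : (0 : ℤ) < m := by exact_mod_cast hm
  have hmq : (m : ℤ) < q1 := Int.ofNat_lt.2 hmq
  set ε := (-1 : ℤ) ^ n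
  -- The determinant is `±1`, so `(q_n, p_n)` and `(q_{n+1}, p_{n+1})` form a basis of the integer
  -- lattice.
  obtain ⟨X, Y, hmX, hkX⟩ : ∃ X Y : ℤ, (m : ℤ) = X * q + Y * q1 ∧ k = X * p + Y * p1 :=
    ⟨ε * (m * p1 - k * q1), ε * (k * q - m * p),
      by linear_combination (-(m : ℤ)) * hε - ε * (m : ℤ) * hdet,
      by linear_combination (-k) * hε - ε * k * hdet⟩
  have hval : (m : ℝ) * α - k = (-1) ^ n * (X * D - Y * D1) := by
    have h1 : (m : ℝ) = X * continuant α n + Y * continuant α (n + 1) := by exact_mod_cast hmX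
    have h2 : (k : ℝ) = X * numerator α n + Y * numerator α (n + 1) := by exact_mod_cast hkX
    rw [pow_succ] at hn1
    rw [h1, h2]
    linear_combination X * hn + Y * hn1
  rw [hval, hn, abs_mul, abs_mul, abs_pow, abs_neg, abs_one, one_pow, one_mul, one_mul,
    abs_of_pos hD]
  -- As `0 < m < q_{n+1}`, nonzero `Y` and `X` have opposite signs; the terms of `X * D - Y * D1`
  -- then do not cancel.
  rcases lt_trichotomy Y 0 with hY | rfl | hY
  · have hX : 1 ≤ X := by
      by_contra! hX
      have : X ≤ 0 := by omega
      nlinarith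
    have hXR : (1 : ℝ) ≤ X := by exact_mod_cast hX
    have hYR : (Y : ℝ) ≤ 0 := by exact_mod_cast hY.le
    exact le_trans (by nlinarith) (le_abs_self _)
  · have hX : 1 ≤ |X| := by
      refine Int.one_le_abs fun h0 => ?_
      subst h0
      simp at hmX
      omega
    have hXR : (1 : ℝ) ≤ |(X : ℝ)| := by exact_mod_cast hX
    rw [Int.cast_zero, zero_mul, sub_zero, abs_mul, abs_of_pos hD]
    nlinarith
  · have hX : X ≤ -1 := by
      by_contra! hX
      have : 0 ≤ X := by omega
      nlinarith
    have hXR : (X : ℝ) ≤ -1 := by exact_mod_cast hX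
    have hYR : (0 : ℝ) ≤ Y := by exact_mod_cast hY.le
    exact le_trans (by nlinarith) (neg_le_abs _)

/-- Adding `q_n` moves `α m` by `p_n` plus an error no larger than its distance to either
neighbouring integer, so no integer is crossed. -/
theorem floor_mul_add_continuant {α : ℝ} (hα : Irrational α) (hα₀ : 0 < α) (hα₁ : α < 1)
    {n m : ℕ} (hm : 0 < m) (hmq : m < continuant α (n + 1)) :
    ⌊α * (m + continuant α n)⌋ = ⌊α * m⌋ + numerator α n := by
  have h0 := abs_continuant_mul_sub_le hα hα₀ hα₁ hm hmq ⌊α * m⌋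
  have h1 := abs_continuant_mul_sub_le hα hα₀ hα₁ hm hmq (⌊α * m⌋ + 1)
  have h2 := Int.floor_le (α * m)
  have h3 := Int.lt_floor_add_one (α * m)
  rw [abs_of_nonneg (by linarith : (0 : ℝ) ≤ m * α - ⌊α * m⌋), abs_le] at h0
  push_cast at h1
  rw [abs_of_nonpos (by linarith : (m : ℝ) * α - (⌊α * m⌋ + 1) ≤ 0), abs_le] at h1
  rw [Int.floor_eq_iff]
  push_cast
  refine ⟨by linarith [h0.1], lt_of_le_of_ne (by linarith [h1.2]) fun he => ?_⟩
  have hirr : Irrational (α * (m + continuant α n : ℕ)) := hα.mul_natCast (by omega)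
  exact hirr ⟨⌊α * m⌋ + numerator α n + 1, by push_cast; linarith⟩

/-! ### Short factors of the characteristic word -/

theorem mechanicalWord_add_continuant {α : ℝ} (hα : Irrational α) (hα₀ : 0 < α) (hα₁ : α < 1)
    {n k : ℕ} (hk : k + 2 < continuant α (n + 1)) :
    mechanicalWord α (k + continuant α n) = mechanicalWord α k := by
  have h1 := floor_mul_add_continuant hα hα₀ hα₁ (Nat.succ_pos k) (n := n) (by omega)
  have h2 := floor_mul_add_continuant hα hα₀ hα₁ (Nat.succ_pos (k + 1)) hk
  have e1 := mechanicalWord_val hα₀ hα₁ k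
  have e2 := mechanicalWord_val hα₀ hα₁ (k + continuant α n)
  push_cast at h1 h2 e2
  rw [show (k : ℝ) + 1 + 1 = k + 2 by ring] at h2
  rw [show (k : ℝ) + continuant α n + 2 = k + 2 + continuant α n by ring,
    show (k : ℝ) + continuant α n + 1 = k + 1 + continuant α n by ring] at e2
  apply Fin.ext
  omega

/-- Subtract `q_n` repeatedly; `t ≤ q_n - 2` is what keeps each step within the range where the
shift by `q_n` is invisible. -/
theorem mechanicalWord_mod_continuant {α : ℝ} (hα : Irrational α) (hα₀ : 0 < α) (hα₁ : α < 1)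
    {n t : ℕ} (ht : t < continuant α n - 1) {i : ℕ} (hi : i < continuant α (n + 1)) :
    mechanicalWord α (i + t) = mechanicalWord α (i % continuant α n + t) := by
  induction i using Nat.strong_induction_on with
  | _ i ih =>
    by_cases hin : i < continuant α n
    · rw [Nat.mod_eq_of_lt hin]
    · have hpos := continuant_pos hα hα₀ hα₁ n
      have h := mechanicalWord_add_continuant hα hα₀ hα₁ (n := n)
        (k := i - continuant α n + t) (by omega)
      rw [show i - continuant α n + t + continuant α n = i + t by omega] at h
      rw [h, ih _ (by omega) (by omega), Nat.mod_eq_sub_mod (by omega : continuant α n ≤ i)]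

theorem exists_lt_continuant {α : ℝ} (hα : Irrational α) (hα₀ : 0 < α) (hα₁ : α < 1) (n i : ℕ) :
    ∃ j < continuant α n, ∀ t < continuant α n - 1,
      mechanicalWord α (i + t) = mechanicalWord α (j + t) := by
  have key : ∀ m i, i < continuant α (n + m) → ∃ j < continuant α n, ∀ t < continuant α n - 1,
      mechanicalWord α (i + t) = mechanicalWord α (j + t) := by
    intro m
    induction m with
    | zero => exact fun i hi => ⟨i, hi, fun _ _ => rfl⟩
    | succ m ih =>
      intro i hi
      obtain ⟨j, hj, h⟩ := ih (i % continuant α (n + m))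
        (Nat.mod_lt _ (continuant_pos hα hα₀ hα₁ _))
      refine ⟨j, hj, fun t ht => ?_⟩
      have := continuant_mono hα hα₀ hα₁ (Nat.le_add_right n m)
      rw [mechanicalWord_mod_continuant hα hα₀ hα₁ (n := n + m) (by omega) hi, h t ht]
  refine key (i + 1) i ?_
  have := le_continuant hα hα₀ hα₁ (n + (i + 1))
  omega

/-- The `q_n` positions below `q_n` exhibit all `q_n` factors of length `q_n - 1`, so none is
repeated. -/
theorem eq_of_agree {α : ℝ} (hα : Irrational α) (hα₀ : 0 < α) (hα₁ : α < 1) {n i j : ℕ}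
    (hi : i < continuant α n) (hj : j < continuant α n)
    (h : ∀ t < continuant α n - 1, mechanicalWord α (i + t) = mechanicalWord α (j + t)) :
    i = j := by
  have hpos := continuant_pos hα hα₀ hα₁ n
  have himage : (fun i => factor (mechanicalWord α) i (continuant α n - 1)) ''
      Set.Iio (continuant α n) = Set.range fun i => factor (mechanicalWord α) i
        (continuant α n - 1) := by
    refine (Set.image_subset_range _ _).antisymm ?_
    rintro _ ⟨i, rfl⟩
    obtain ⟨j, hj, h⟩ := exists_lt_continuant hα hα₀ hα₁ n i
    exact ⟨j, hj, factor_eq_iff.2 fun t ht => (h t ht).symm⟩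
  have hcard := ((isBalancedWithSlope_mechanicalWord hα hα₀ hα₁).isSturmian hα).complexity_eq
    (continuant α n - 1)
  rw [complexity, ← himage] at hcard
  refine Set.injOn_of_ncard_image_eq
    (f := fun i => factor (mechanicalWord α) i (continuant α n - 1)) ?_ (Set.finite_Iio _) hi hj
    (factor_eq_iff.2 h)
  rw [hcard, ← Finset.coe_Iio, Set.ncard_coe_finset, Nat.card_Iio]
  omega

/-! ### Formal intercepts -/

theorem shift_iterate_apply (x : Word) (n k : ℕ) : shift^[n] x k = x (n + k) := by
  induction n generalizing x with
  | zero => simp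
  | succ n ih =>
    rw [Function.iterate_succ_apply, ih, shift]
    congr 1
    omega

theorem mem_formalIntercepts_mod {α : ℝ} {ρ : ℕ → ℕ} (hρ : ρ ∈ formalIntercepts α) (n : ℕ) :
    ρ (n + 1) % continuant α n = ρ n := by
  rw [hρ.2 n, Nat.mod_eq_of_lt (hρ.1 n)]

theorem agree_of_le {α : ℝ} (hα : Irrational α) (hα₀ : 0 < α) (hα₁ : α < 1) {ρ : ℕ → ℕ}
    (hρ : ρ ∈ formalIntercepts α) {n m t : ℕ} (ht : t < continuant α n - 1) (hnm : n ≤ m) :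
    mechanicalWord α (ρ m + t) = mechanicalWord α (ρ n + t) := by
  induction m, hnm using Nat.le_induction with
  | base => rfl
  | succ m hnm ih =>
    have := continuant_mono hα hα₀ hα₁ hnm
    rw [mechanicalWord_mod_continuant hα hα₀ hα₁ (n := m) (by omega) (hρ.1 _),
      mem_formalIntercepts_mod hρ, ih]

theorem tendsto_formalShift {α : ℝ} (hα : Irrational α) (hα₀ : 0 < α) (hα₁ : α < 1) {ρ : ℕ → ℕ}
    (hρ : ρ ∈ formalIntercepts α) :
    Tendsto (fun n => shift^[ρ n] (mechanicalWord α)) atTop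
      (𝓝 (formalShift ρ (mechanicalWord α))) := by
  have h : Tendsto (fun n => shift^[ρ n] (mechanicalWord α)) atTop
      -- Since `q_{k+2} ≥ k + 2`, index `k` lies in the stable prefix of length `q_{k+2} - 1`.
      (𝓝 fun k => mechanicalWord α (ρ (k + 2) + k)) := by
    rw [tendsto_pi_nhds]
    intro k
    refine tendsto_const_nhds.congr' ?_
    filter_upwards [eventually_ge_atTop (k + 2)] with n hn
    have := le_continuant hα hα₀ hα₁ (k + 2)
    rw [shift_iterate_apply, agree_of_le hα hα₀ hα₁ hρ (n := k + 2) (by omega) hn]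
  exact tendsto_nhds_limUnder ⟨_, h⟩

theorem formalShift_apply {α : ℝ} (hα : Irrational α) (hα₀ : 0 < α) (hα₁ : α < 1) {ρ : ℕ → ℕ}
    (hρ : ρ ∈ formalIntercepts α) {n t : ℕ} (ht : t < continuant α n - 1) :
    formalShift ρ (mechanicalWord α) t = mechanicalWord α (ρ n + t) := by
  have h := tendsto_pi_nhds.1 (tendsto_formalShift hα hα₀ hα₁ hρ) t
  refine tendsto_nhds_unique h (tendsto_const_nhds.congr' ?_)
  filter_upwards [eventually_ge_atTop n] with m hm
  rw [shift_iterate_apply, agree_of_le hα hα₀ hα₁ hρ ht hm]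

theorem isBalancedWithSlope_formalShift {α : ℝ} (hα : Irrational α) (hα₀ : 0 < α) (hα₁ : α < 1)
    {ρ : ℕ → ℕ} (hρ : ρ ∈ formalIntercepts α) :
    IsBalancedWithSlope (formalShift ρ (mechanicalWord α)) α := by
  intro a n
  have h := isBalancedWithSlope_mechanicalWord hα hα₀ hα₁ (ρ (a + n + 1) + a) n
  have hle := le_continuant hα hα₀ hα₁ (a + n + 1)
  rwa [ones_congr fun k hk => ?_]
  rw [formalShift_apply hα hα₀ hα₁ hρ (n := a + n + 1) (by omega), ← add_assoc]

theorem formalShift_injOn {α : ℝ} (hα : Irrational α) (hα₀ : 0 < α) (hα₁ : α < 1) :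
    Set.InjOn (fun ρ => formalShift ρ (mechanicalWord α)) (formalIntercepts α) := by
  intro ρ hρ σ hσ h
  funext n
  refine eq_of_agree hα hα₀ hα₁ (hρ.1 n) (hσ.1 n) fun t ht => ?_
  rw [← formalShift_apply hα hα₀ hα₁ hρ ht, ← formalShift_apply hα hα₀ hα₁ hσ ht]
  exact congrFun h t

/-- By the common language, each prefix of `x` of length `q_n - 1` occurs in `c` at a position `ρ_n
< q_n`, and uniqueness of that position forces the congruences. -/
theorem exists_formalShift_eq {α : ℝ} (hα : Irrational α) (hα₀ : 0 < α) (hα₁ : α < 1) {x : Word}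
    (hx : IsBalancedWithSlope x α) :
    ∃ ρ ∈ formalIntercepts α, formalShift ρ (mechanicalWord α) = x := by
  have hex : ∀ n, ∃ j < continuant α n, ∀ t < continuant α n - 1,
      x t = mechanicalWord α (j + t) := by
    intro n
    obtain ⟨i, hi⟩ := ((isBalancedWithSlope_mechanicalWord hα hα₀ hα₁).isFactor_iff hα).2
      (hx.factor_mem 0 (continuant α n - 1))
    rw [length_factor, factor_eq_iff] at hi
    obtain ⟨j, hj, h⟩ := exists_lt_continuant hα hα₀ hα₁ n i
    exact ⟨j, hj, fun t ht => by rw [← h t ht, ← hi t ht, zero_add]⟩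
  choose ρ hlt hagree using hex
  have hρ : ρ ∈ formalIntercepts α := by
    refine ⟨hlt, fun n => ?_⟩
    have h : ρ (n + 1) % continuant α n = ρ n := by
      refine eq_of_agree hα hα₀ hα₁ (Nat.mod_lt _ (continuant_pos hα hα₀ hα₁ n)) (hlt n)
        fun t ht => ?_
      have := continuant_mono hα hα₀ hα₁ (Nat.le_add_right n 1)
      rw [← mechanicalWord_mod_continuant hα hα₀ hα₁ ht (hlt (n + 1)), ← hagree n t ht,
        ← hagree (n + 1) t (by omega)]
    rw [Nat.ModEq, h, Nat.mod_eq_of_lt (hlt n)]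
  refine ⟨ρ, hρ, funext fun t => ?_⟩
  have := le_continuant hα hα₀ hα₁ (t + 2)
  have ht : t < continuant α (t + 2) - 1 := by omega
  rw [formalShift_apply hα hα₀ hα₁ hρ ht, hagree _ t ht]

theorem bijOn_formalShift {α : ℝ} (hα : Irrational α) (hα₀ : 0 < α) (hα₁ : α < 1) :
    Set.BijOn (fun ρ => formalShift ρ (mechanicalWord α)) (formalIntercepts α)
      {x | IsSturmian x ∧ HasSlope x α} :=
  ⟨fun _ hρ => (isBalancedWithSlope_iff hα).1 (isBalancedWithSlope_formalShift hα hα₀ hα₁ hρ),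
    formalShift_injOn hα hα₀ hα₁,
    fun _ hx => exists_formalShift_eq hα hα₀ hα₁ ((isBalancedWithSlope_iff hα).2 hx)⟩

/-! ### Ostrowski expansions -/

theorem ostrowskiSums_succ (α : ℝ) (b : ℕ → ℕ) (n : ℕ) :
    ostrowskiSums α b (n + 1) = ostrowskiSums α b n + b n * continuant α n :=
  Finset.sum_range_succ _ _

/-- Two consecutive bounds are carried because a maximal digit makes the preceding one vanish, and
the sum before it is then already below the smaller continuant. -/
theorem IsOstrowski.ostrowskiSums_lt {α : ℝ} {b : ℕ → ℕ} (hb : IsOstrowski α b) (n : ℕ) :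
    ostrowskiSums α b n < continuant α n ∧ ostrowskiSums α b (n + 1) < continuant α (n + 1) := by
  induction n with
  | zero =>
    have := hb.1
    constructor <;> simp [ostrowskiSums, continuant]
    omega
  | succ n ih =>
    refine ⟨ih.2, ?_⟩
    rw [ostrowskiSums_succ, continuant]
    rcases (hb.2.1 (n + 1)).lt_or_eq with hlt | heq
    · have := Nat.mul_le_mul_right (continuant α (n + 1)) hlt
      rw [Nat.succ_mul] at this
      omega
    · have h := ostrowskiSums_succ α b n
      rw [hb.2.2 n heq, zero_mul] at h
      rw [heq]
      omega

theorem bijOn_ostrowskiSums {α : ℝ} (hα : Irrational α) (hα₀ : 0 < α) (hα₁ : α < 1) :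
    Set.BijOn (ostrowskiSums α) {b | IsOstrowski α b} (formalIntercepts α) := by
  refine ⟨fun b hb => ⟨fun n => (hb.ostrowskiSums_lt n).1, fun n => ?_⟩, fun b _ b' _ h => ?_,
    fun ρ hρ => ?_⟩
  · rw [ostrowskiSums_succ]
    exact Nat.add_mul_mod_self_right _ _ _
  · funext n
    have h1 := ostrowskiSums_succ α b n
    rw [h, ostrowskiSums_succ] at h1
    exact (Nat.eq_of_mul_eq_mul_right (continuant_pos hα hα₀ hα₁ n)
      (Nat.add_left_cancel h1)).symm
  · set b : ℕ → ℕ := fun n => ρ (n + 1) / continuant α n with hb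
    have hstep : ∀ n, ρ (n + 1) = ρ n + b n * continuant α n := fun n => by
      have := Nat.mod_add_div (ρ (n + 1)) (continuant α n)
      rw [mem_formalIntercepts_mod hρ, mul_comm] at this
      exact this.symm
    have hb0 : b 0 + 1 ≤ partialQuotient α 0 := by
      have := hρ.1 1
      simp only [hb, continuant] at this ⊢
      simpa using this
    refine ⟨b, ⟨hb0, fun i => ?_, fun i hi => ?_⟩, funext fun n => ?_⟩
    · rcases i with _ | i
      · omega
      · have h1 := hρ.1 (i + 1 + 1)
        have h2 := continuant_mono hα hα₀ hα₁ (Nat.le_add_right i 1)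
        rw [continuant] at h1
        -- `ρ_{i+2} < a_{i+2} q_{i+1} + q_i ≤ (a_{i+2} + 1) q_{i+1}`.
        refine Nat.le_of_lt_succ ((Nat.div_lt_iff_lt_mul (continuant_pos hα hα₀ hα₁ _)).2 ?_)
        rw [Nat.succ_mul]
        omega
    -- A maximal digit leaves `ρ_{i+1} < q_i`, so the preceding quotient is `0`.
    · have h1 := hρ.1 (i + 2)
      rw [hstep, hi, continuant] at h1
      exact Nat.div_eq_of_lt (by omega)
    · induction n with
      | zero =>
        have := hρ.1 0
        simp only [continuant] at this
        simp only [ostrowskiSums, Finset.range_zero, Finset.sum_empty]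
        omega
      | succ n ih => rw [ostrowskiSums_succ, ih, hstep]

end Sturmian

theorem proposition12 (α : ℝ) (hα : Irrational α) (hα₀ : 0 < α) (hα₁ : α < 1) :
    -- the characteristic word of slope `α` exists and is unique
    (∀ c : Sturmian.Word, Sturmian.IsCharacteristic α c ↔ c = Sturmian.characteristicWord α) ∧
    -- existence and uniqueness of the formal intercept
    (∀ x : Sturmian.Word, Sturmian.IsSturmian x → Sturmian.HasSlope x α →
      ∃! ρ : ℕ → ℕ, ρ ∈ Sturmian.formalIntercepts α ∧
        x = Sturmian.formalShift ρ (Sturmian.characteristicWord α)) ∧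
    -- the limit that defines `T^ρ(c_α)` exists and agrees with `T^{ρ_n}(c_α)` on the first `q_n - 1` letters
    (∀ ρ ∈ Sturmian.formalIntercepts α,
      Tendsto (fun n => Sturmian.shift^[ρ n] (Sturmian.characteristicWord α)) atTop
        (𝓝 (Sturmian.formalShift ρ (Sturmian.characteristicWord α))) ∧
      ∀ n, Sturmian.firstLetters (Sturmian.formalShift ρ (Sturmian.characteristicWord α))
          (Sturmian.continuant α n - 1) =
        Sturmian.firstLetters (Sturmian.shift^[ρ n] (Sturmian.characteristicWord α))
          (Sturmian.continuant α n - 1)) ∧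
    -- formal intercepts of `α` correspond to Sturmian words of slope `α`
    Set.BijOn (fun ρ => Sturmian.formalShift ρ (Sturmian.characteristicWord α))
      (Sturmian.formalIntercepts α) {x | Sturmian.IsSturmian x ∧ Sturmian.HasSlope x α} ∧
    -- Ostrowski expansions correspond to formal intercepts of `α`
    Set.BijOn (Sturmian.ostrowskiSums α) {b | Sturmian.IsOstrowski α b}
      (Sturmian.formalIntercepts α) := by
  rw [Sturmian.characteristicWord_eq hα hα₀ hα₁]
  refine ⟨fun c => Sturmian.isCharacteristic_iff hα hα₀ hα₁, fun x hx hs => ?_, fun ρ hρ =>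
    ⟨Sturmian.tendsto_formalShift hα hα₀ hα₁ hρ, fun n => ?_⟩,
    Sturmian.bijOn_formalShift hα hα₀ hα₁, Sturmian.bijOn_ostrowskiSums hα hα₀ hα₁⟩
  · obtain ⟨ρ, hρ, rfl⟩ :=
      Sturmian.exists_formalShift_eq hα hα₀ hα₁ (hx.isBalancedWithSlope hs hα)
    exact ⟨ρ, ⟨hρ, rfl⟩, fun σ hσ => Sturmian.formalShift_injOn hα hα₀ hα₁ hσ.1 hρ hσ.2.symm⟩
  · refine Sturmian.factor_eq_iff.2 fun t ht => ?_
    rw [zero_add, Sturmian.formalShift_apply hα hα₀ hα₁ hρ ht, Sturmian.shift_iterate_apply]
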